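/- Let $n\in\mathbb N$ and let $R$ be a real closed field with ordering $\le$. Put $\mathcal O=\{a\in R : |a|\le N \text{ for some } N\in\mathbb N\}$, a valuation ring with maximal ideal $\mathfrak m=\{a\in R : N|a|\le 1 \text{ for all } N\in\mathbb N\}$; its residue field $\mathcal O/\mathfrak m$ is an archimedean ordered field and is regarded as a subfield of $\mathbb R$ via its unique order embedding. For a commutative ring $A$ let $A\langle\bar X\rangle$ be the ring of polynomials in the noncommuting variables $X_1,\dots,X_n$ with coefficients in $A$, with the $A$-linear involution $*$ which fixes each $X_i$ and reverses words, and let $\operatorname{Sym}A\langle\bar X\rangle=\{g : g^*=g\}$. Two elements of $A\langle\bar X\rangle$ are called cyclically equivalent if their difference is a sum of commutators $pq-qp$ with $p,q\in A\langle\bar X\rangle$. Let $M_R\subseteq\operatorname{Sym}R\langle\bar X\rangle$ be the quadratic module generated by $1-X_1^2,\dots,1-X_n^2$, i.e. the smallest set $M\subseteq\operatorname{Sym}R\langle\bar X\rangle$ containing $1$ and these elements such that $M+M\subseteq M$ and $g^*Mg\subseteq M$ for all $g\in R\langle\bar X\rangle$. A tracial contraction state on $\mathbb R\langle\bar X\rangle$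 is a linear map $\varphi:\mathbb R\langle\bar X\rangle\to\mathbb R$ such that $\varphi(pq)=\varphi(qp)$, $\varphi(p^*p)\ge 0$ and $\varphi(p^*)=\varphi(p)$ for all $p,q\in\mathbb R\langle\bar X\rangle$, $|\varphi(w)|\le 1$ for every word $w$ in $X_1,\dots,X_n$, and $\varphi(1)=1$. Let $f\in\operatorname{Sym}\mathcal O\langle\bar X\rangle$ and let $\overline f\in\mathbb R\langle\bar X\rangle$ be obtained from $f$ by applying $\mathcal O\to\mathcal O/\mathfrak m\subseteq\mathbb R$ to its coefficients. Suppose that $\varphi(\overline f)\ge 0$ for all tracial contraction states $\varphi$ on $\mathbb R\langle\bar X\rangle$. Then for every $\varepsilon\in R$ with $\varepsilon>0$ and $\varepsilon\notin\mathfrak m$, the polynomial $f+\varepsilon$ is cyclically equivalent in $R\langle\bar X\rangle$ to an element of $M_R$. -/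

import Mathlib

/-! ### Quadratic modules and cyclic equivalence -/

/-- A quadratic module in a ring `A` with involution: a set `M` of symmetric elements with
`1 ∈ M`, `M + M ⊆ M` and `g* M g ⊆ M` for all `g ∈ A`. -/
structure IsQuadraticModule {A : Type*} [Ring A] [StarRing A] (M : Set A) : Prop where
  symm : ∀ a ∈ M, star a = a
  one_mem : (1 : A) ∈ M
  add_mem : ∀ a ∈ M, ∀ b ∈ M, a + b ∈ M
  conj_mem : ∀ (g : A), ∀ a ∈ M, star g * a * g ∈ M

/-- The quadratic module generated by a set `S` (of symmetric elements): the intersection of all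
quadratic modules containing `S`. -/
def quadraticModuleGeneratedBy {A : Type*} [Ring A] [StarRing A] (S : Set A) : Set A :=
  ⋂₀ {M : Set A | IsQuadraticModule M ∧ S ⊆ M}

theorem isQuadraticModule_generatedBy {A : Type*} [Ring A] [StarRing A] {S : Set A}
    (hS : ∀ a ∈ S, star a = a) : IsQuadraticModule (quadraticModuleGeneratedBy S) where
  symm a ha := by
    refine ha {b : A | star b = b} ⟨⟨fun _ h => h, star_one A, fun b hb c hc => ?_,
      fun g b hb => ?_⟩, hS⟩
    · exact (star_add b c).trans (congrArg₂ (· + ·) hb hc)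
    · change star (star g * b * g) = star g * b * g
      rw [star_mul, star_mul, star_star, show star b = b from hb, mul_assoc]
  one_mem _ hM := hM.1.one_mem
  add_mem a ha b hb M hM := hM.1.add_mem a (ha M hM) b (hb M hM)
  conj_mem g a ha M hM := hM.1.conj_mem g a (ha M hM)

/-- Two elements are cyclically equivalent if their difference is a sum of commutators. -/
def CyclicallyEquivalent {A : Type*} [Ring A] (f g : A) : Prop :=
  f - g ∈ AddSubmonoid.closure {c : A | ∃ p q : A, c = p * q - q * p}

/-! ### Polynomials in noncommuting variables

For a commutative ring `R`, the ring of polynomials in the noncommuting variables `X_1, …, X_n` is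
`FreeAlgebra R (Fin n)`, the variables being `FreeAlgebra.ι R i`. Its `star` is Mathlib's: it is
`R`-linear, fixes each variable and reverses products, that is, it is the extension of the
identity involution of `R`. -/

/-- The quadratic module `M_R` generated by `1 - X_1 ^ 2, …, 1 - X_n ^ 2` in `R⟨X_1, …, X_n⟩`,
where `R` carries the identity as its involution. -/
def cubeModule (R : Type*) [CommRing R] (n : ℕ) : Set (FreeAlgebra R (Fin n)) :=
  quadraticModuleGeneratedBy (Set.range fun i : Fin n => 1 - FreeAlgebra.ι R i ^ 2)

/-- The word `w`, seen as a polynomial with coefficient `1`. -/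
def wordPoly (R : Type*) [CommRing R] {n : ℕ} (w : FreeMonoid (Fin n)) : FreeAlgebra R (Fin n) :=
  FreeMonoid.lift (FreeAlgebra.ι R) w

/-- Tracial contraction states on `ℝ⟨X_1, …, X_n⟩`. -/
structure IsTracialContractionState {n : ℕ} (φ : FreeAlgebra ℝ (Fin n) →ₗ[ℝ] ℝ) : Prop where
  tracial : ∀ f g, φ (f * g) = φ (g * f)
  contraction : ∀ w : FreeMonoid (Fin n), |φ (wordPoly ℝ w)| ≤ 1
  hermitian_square_nonneg : ∀ f, 0 ≤ φ (star f * f)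
  map_one : φ 1 = 1
  map_star : ∀ f, φ (star f) = φ f

/-- The ring homomorphism `A⟨X⟩ → B⟨X⟩` that applies a ring homomorphism `A → B` to the
coefficients and sends each variable to itself. -/
def mapCoeff {A B : Type*} [CommRing A] [CommRing B] (h : A →+* B) (n : ℕ) :
    FreeAlgebra A (Fin n) →+* FreeAlgebra B (Fin n) :=
  letI : Algebra A B := h.toAlgebra
  (FreeAlgebra.lift A (FreeAlgebra.ι B) :
    FreeAlgebra A (Fin n) →ₐ[A] FreeAlgebra B (Fin n)).toRingHom

theorem mapCoeff_var {A B : Type*} [CommRing A] [CommRing B] (h : A →+* B) (n : ℕ) (i : Fin n) :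
    mapCoeff h n (FreeAlgebra.ι A i) = FreeAlgebra.ι B i := by
  let _ : Algebra A B := h.toAlgebra
  exact FreeAlgebra.lift_ι_apply (R := A) (FreeAlgebra.ι B) i

theorem mapCoeff_const {A B : Type*} [CommRing A] [CommRing B] (h : A →+* B) (n : ℕ) (a : A) :
    mapCoeff h n (algebraMap A _ a) = algebraMap B _ (h a) := by
  let _ : Algebra A B := h.toAlgebra
  exact (FreeAlgebra.lift A (FreeAlgebra.ι B (X := Fin n))).commutes a

/-! ### Finite elements and infinitesimals of an ordered field

The ring `𝒪` of finite elements of an ordered field `R` is Mathlib's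
`ArchimedeanClass.FiniteElement R`, with residue field `ArchimedeanClass.FiniteResidueField R`. -/

/-- An element `a` belongs to `𝒪` if and only if `|a| ≤ N` for some natural number `N`. -/
theorem mem_finite_iff {R : Type*} [Field R] [LinearOrder R] [IsStrictOrderedRing R] (a : R) :
    0 ≤ ArchimedeanClass.mk a ↔ ∃ N : ℕ, |a| ≤ N := by
  rw [← ArchimedeanClass.mk_one, ArchimedeanClass.mk_le_mk]
  simp

/-- The inclusion `𝒪 → R`. -/
def finiteInclusion (R : Type*) [Field R] [LinearOrder R] [IsStrictOrderedRing R] :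
    ArchimedeanClass.FiniteElement R →+* R where
  toFun a := a.1
  map_one' := rfl
  map_mul' _ _ := rfl
  map_zero' := rfl
  map_add' _ _ := rfl

/-- The homomorphism `𝒪 → 𝒪/𝔪 ⊆ ℝ`, where `𝒪/𝔪` is embedded in `ℝ` in the unique way. -/
noncomputable def finiteResidue (R : Type*) [Field R] [LinearOrder R] [IsStrictOrderedRing R] :
    ArchimedeanClass.FiniteElement R →+* ℝ where
  toFun a := ArchimedeanClass.stdPart a.1
  map_one' := ArchimedeanClass.stdPart_one
  map_mul' a b := ArchimedeanClass.stdPart_mul a.2 b.2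
  map_zero' := ArchimedeanClass.stdPart_zero
  map_add' a b := ArchimedeanClass.stdPart_add a.2 b.2

/-- `finiteResidue` is the residue map followed by any (hence the only) embedding of the ordered
residue field into `ℝ`. -/
theorem finiteResidue_eq {R : Type*} [Field R] [LinearOrder R] [IsStrictOrderedRing R]
    (e : ArchimedeanClass.FiniteResidueField R →+*o ℝ) (a : ArchimedeanClass.FiniteElement R) :
    finiteResidue R a = e (ArchimedeanClass.FiniteResidueField.mk a) :=
  ArchimedeanClass.stdPart_of_mk_nonneg e a.2

/-- The ideal `𝔪` of infinitesimals, as a subset of `R`. -/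
def infinitesimals (R : Type*) [Field R] [LinearOrder R] [IsStrictOrderedRing R] : Set R :=
  {a : R | ∀ N : ℕ, N * |a| ≤ 1}

/-- `𝔪` is the set of nonunits, that is, the maximal ideal, of the local ring `𝒪`. -/
theorem infinitesimals_eq (R : Type*) [Field R] [LinearOrder R] [IsStrictOrderedRing R] :
    infinitesimals R =
      finiteInclusion R '' nonunits (ArchimedeanClass.FiniteElement R) := by
  have key : ∀ a : R, a ∈ infinitesimals R ↔ 0 < ArchimedeanClass.mk a := by
    intro a
    rw [← ArchimedeanClass.mk_one, ArchimedeanClass.mk_lt_mk]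
    simp only [infinitesimals, Set.mem_ofPred_eq, abs_one, nsmul_eq_mul]
    refine ⟨fun h N => ?_, fun h N => (h N).le⟩
    rcases (abs_nonneg a).eq_or_lt with h0 | h0
    · simp [← h0]
    · have h1 := h (N + 1)
      push_cast at h1
      linarith
  ext a
  rw [key]
  constructor
  · intro h
    exact ⟨.mk a h.le, ArchimedeanClass.FiniteElement.not_isUnit_iff_mk_pos.2 (by exact h), rfl⟩
  · rintro ⟨b, hb, rfl⟩
    exact ArchimedeanClass.FiniteElement.not_isUnit_iff_mk_pos.1 hb

/-!
The positivity asked for is first treated as membership in a cone. Over a real closed field `R`, let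
`C` be the set of `x` such that `x + x*` is cyclically equivalent to an element of `M_R`
(`tracialCone`). It contains all `p* p`, all commutators and all `p - p*`, and it contains
`|a| + a w` for scalars `a` and words `w`, since `1 - w* w ∈ M_R`. Hence `c + p ∈ C` as soon as `c`
is at least the sum `‖p‖` of the absolute values of the coefficients of `p`: the constants are
order units, in a quantitative way.

The passage from `R` to `ℝ` and back is made at the level of cones, so that neither an embedding of
`ℝ` or of the residue field into `R` nor a transfer principle is needed. Let `K ⊆ ℝ⟨X⟩` be the
closure, for the norm `‖·‖`, of the residues of the polynomials over `𝒪` that lie in `C`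
(`residueCone`). Residues are dense, already because of rational coefficients, so `K` is a real
convex cone with order unit `1` that contains all `p* p`, commutators and skew elements. A
normalized functional nonnegative on `K` is therefore a tracial contraction state
(`isTracialContractionState_of_nonneg`), and the Hahn-Banach theorem in the form of Riesz extension
(`exists_nonneg_functional_of_notMem`) puts the residue of `f + δ` into `K` for every real `δ > 0`.

Finally, if the residue of `f + δ` is within `δ` of the residue of some `h` in `C`, then
`‖f + δ - h‖ < δ` in `𝒪`, because standard parts reflect strict inequalities, and so
`f + 2δ = (δ + (f + δ - h)) + h` lies in `C` (`add_algebraMap_mem_tracialCone`). A positive `ε` that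
is not infinitesimal is at least `2δ` for some rational `δ > 0`, and the symmetric elements of `C`
are cyclically equivalent to elements of `M_R`.
-/

/-! ### Positive functionals on a cone with an order unit -/

/-- If `u` is an order unit of the convex cone `K`, every point outside `K` is weakly separated from
`K` by a functional with value `1` at `u`. Riesz extension is applied to the cone generated by `K`
and `-x`, starting from the line through `u`. -/
theorem exists_nonneg_functional_of_notMem {V : Type*} [AddCommGroup V] [Module ℝ V]
    (K : PointedCone ℝ V) {u : V} (huK : u ∈ K) (hu : ∀ v, ∃ t : ℝ, t • u + v ∈ K)
    {x : V} (hx : x ∉ K) :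
    ∃ φ : V →ₗ[ℝ] ℝ, (∀ v ∈ K, 0 ≤ φ v) ∧ φ u = 1 ∧ φ x ≤ 0 := by
  have hsmul : ∀ c : ℝ, 0 ≤ c → ∀ v ∈ K, c • v ∈ K := fun c hc v hv => K.smul_mem hc hv
  -- otherwise `u` and `-u` both lie in `K`, which is then everything
  have hneg : -u ∉ K := by
    intro h
    obtain ⟨t, ht⟩ := hu x
    apply hx
    have h1 : (-t) • u ∈ K := by
      rcases le_total 0 t with h0 | h0
      · simpa using hsmul t h0 _ h
      · exact hsmul _ (neg_nonneg.2 h0) _ huK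
    simpa using K.add_mem h1 ht
  have hu0 : u ≠ 0 := by
    rintro rfl
    exact hneg (by simp)
  let K' : PointedCone ℝ V := K ⊔ Submodule.span _ {-x}
  have hK' : ∀ v, v ∈ K' ↔ ∃ k ∈ K, ∃ s : ℝ, 0 ≤ s ∧ k + s • (-x) = v := by
    intro v
    simp only [K', Submodule.mem_sup, Submodule.mem_span_singleton]
    constructor
    · rintro ⟨k, hk, _, ⟨s, rfl⟩, rfl⟩
      exact ⟨k, hk, s.1, s.2, rfl⟩
    · rintro ⟨k, hk, s, hs, rfl⟩
      exact ⟨k, hk, _, ⟨⟨s, hs⟩, rfl⟩, rfl⟩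
  obtain ⟨φ, hφ, hφK⟩ := riesz_extension K' (LinearPMap.mkSpanSingleton u (1 : ℝ) hu0)
    (by
      rintro ⟨y, hy⟩ hyK
      obtain ⟨c, rfl⟩ := Submodule.mem_span_singleton.1 hy
      rw [LinearPMap.mkSpanSingleton'_apply]
      simp only [RingHom.id_apply, smul_eq_mul, mul_one]
      by_contra! hc
      obtain ⟨k, hk, s, hs, hks⟩ := (hK' _).1 hyK
      have hsx : s • x = k + (-c) • u := by
        have : c • u = k + s • (-x) := hks.symm
        rw [neg_smul, this]
        simp
      rcases hs.eq_or_lt with rfl | hs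
      · refine hneg ?_
        have := hsmul (-c)⁻¹ (by rw [inv_nonneg]; linarith) k hk
        rw [zero_smul] at hsx
        rw [eq_neg_of_add_eq_zero_left hsx.symm, smul_neg, smul_smul,
          inv_mul_cancel₀ (by linarith), one_smul] at this
        exact this
      · refine hx ?_
        have := hsmul s⁻¹ (inv_nonneg.2 hs.le) _
          (K.add_mem hk (hsmul (-c) (by linarith) u huK))
        rwa [← hsx, smul_smul, inv_mul_cancel₀ hs.ne', one_smul] at this)
    (by
      intro y
      obtain ⟨t, ht⟩ := hu y
      exact ⟨⟨t • u, Submodule.mem_span_singleton.2 ⟨t, rfl⟩⟩,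
        (hK' _).2 ⟨_, ht, 0, le_rfl, by simp⟩⟩)
  refine ⟨φ, fun v hv => hφK v ((hK' v).2 ⟨v, hv, 0, le_rfl, by simp⟩), ?_, ?_⟩
  · refine (hφ ⟨u, Submodule.mem_span_singleton_self u⟩).trans ?_
    rw [LinearPMap.mkSpanSingleton_apply]
  · have := hφK (-x) ((hK' _).2 ⟨0, K.zero_mem, 1, zero_le_one, by simp⟩)
    simpa using this

/-! ### Words, coefficients and the coefficient norm -/

namespace FreeAlgebra

variable {A : Type*} [CommRing A] {n : ℕ}

theorem basisFreeMonoid_eq_wordPoly (w : FreeMonoid (Fin n)) :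
    basisFreeMonoid A (Fin n) w = wordPoly A w := by
  simp [basisFreeMonoid, equivMonoidAlgebraFreeMonoid, wordPoly]

theorem repr_smul_wordPoly (a : A) (w : FreeMonoid (Fin n)) :
    (basisFreeMonoid A (Fin n)).repr (a • wordPoly A w) = Finsupp.single w a := by
  rw [← basisFreeMonoid_eq_wordPoly, map_smul, Module.Basis.repr_self, Finsupp.smul_single,
    smul_eq_mul, mul_one]

theorem sum_repr_wordPoly (p : FreeAlgebra A (Fin n)) :
    ((basisFreeMonoid A (Fin n)).repr p).sum (fun w a => a • wordPoly A w) = p := by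
  simpa only [Finsupp.linearCombination_apply, basisFreeMonoid_eq_wordPoly] using
    (basisFreeMonoid A (Fin n)).linearCombination_repr p

theorem star_wordPoly (w : FreeMonoid (Fin n)) : star (wordPoly A w) = wordPoly A (star w) := by
  induction w using FreeMonoid.inductionOn' with
  | one => simp [wordPoly]
  | of_mul i w ih =>
    simp only [wordPoly, map_mul, star_mul, FreeMonoid.lift_eval_of, star_ι] at ih ⊢
    rw [ih, FreeMonoid.star_of, FreeMonoid.lift_eval_of]

theorem star_smul_eq (a : A) (p : FreeAlgebra A (Fin n)) : star (a • p) = a • star p := by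
  rw [Algebra.smul_def, star_mul, star_algebraMap, Algebra.smul_def, Algebra.commutes]

section mapCoeff

variable {B : Type*} [CommRing B] (h : A →+* B)

theorem mapCoeff_smul (a : A) (p : FreeAlgebra A (Fin n)) :
    mapCoeff h n (a • p) = h a • mapCoeff h n p := by
  rw [Algebra.smul_def, map_mul, mapCoeff_const, Algebra.smul_def]

theorem mapCoeff_wordPoly (w : FreeMonoid (Fin n)) :
    mapCoeff h n (wordPoly A w) = wordPoly B w := by
  induction w using FreeMonoid.inductionOn' with
  | one => simp [wordPoly]
  | of_mul i w ih =>
    simp only [wordPoly, map_mul, FreeMonoid.lift_eval_of, mapCoeff_var] at ih ⊢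
    rw [ih]

theorem mapCoeff_star (p : FreeAlgebra A (Fin n)) :
    mapCoeff h n (star p) = star (mapCoeff h n p) := by
  induction p using FreeAlgebra.induction with
  | grade0 a => simp [mapCoeff_const]
  | grade1 i => simp [mapCoeff_var]
  | mul p q hp hq => simp [hp, hq]
  | add p q hp hq => simp [hp, hq]

theorem repr_mapCoeff (p : FreeAlgebra A (Fin n)) :
    (basisFreeMonoid B (Fin n)).repr (mapCoeff h n p) =
      ((basisFreeMonoid A (Fin n)).repr p).mapRange h h.map_zero := by
  classical
  conv_lhs => rw [← sum_repr_wordPoly p]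
  simp only [Finsupp.sum, map_sum, mapCoeff_smul, mapCoeff_wordPoly, repr_smul_wordPoly]
  ext w
  simp only [Finsupp.finsetSum_apply, Finsupp.single_apply, Finsupp.mapRange_apply]
  rw [Finset.sum_ite_eq']
  split_ifs with hw
  · rfl
  · rw [Finsupp.notMem_support_iff.1 hw, map_zero]

end mapCoeff

section coeffNorm

variable [LinearOrder A]

/-- The sum of the absolute values of the coefficients, with values in the coefficient ring. -/
noncomputable def coeffNorm (p : FreeAlgebra A (Fin n)) : A :=
  ((basisFreeMonoid A (Fin n)).repr p).sum fun _ a => |a|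

theorem coeffNorm_mapCoeff {B : Type*} [CommRing B] [LinearOrder B] [IsStrictOrderedRing A]
    [IsStrictOrderedRing B] {h : A →+* B} (hh : Monotone h) (p : FreeAlgebra A (Fin n)) :
    coeffNorm (mapCoeff h n p) = h (coeffNorm p) := by
  have habs (a : A) : |h a| = h |a| := by
    rcases le_total 0 a with ha | ha
    · rw [abs_of_nonneg ha, abs_of_nonneg (by simpa using hh ha)]
    · rw [abs_of_nonpos ha, abs_of_nonpos (by simpa using hh ha), map_neg]
  rw [coeffNorm, repr_mapCoeff, Finsupp.sum_mapRange_index (by simp), coeffNorm, Finsupp.sum,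
    Finsupp.sum, map_sum]
  simp only [habs]

theorem coeffNorm_smul_wordPoly [IsStrictOrderedRing A] (a : A) (w : FreeMonoid (Fin n)) :
    coeffNorm (a • wordPoly A w) = |a| := by
  rw [coeffNorm, repr_smul_wordPoly, Finsupp.sum_single_index (by simp)]

theorem coeffNorm_zero : coeffNorm (0 : FreeAlgebra A (Fin n)) = 0 := by
  simp [coeffNorm]

theorem coeffNorm_add_le [IsStrictOrderedRing A] (p q : FreeAlgebra A (Fin n)) :
    coeffNorm (p + q) ≤ coeffNorm p + coeffNorm q := by
  classical
  let b := (basisFreeMonoid A (Fin n)).repr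
  have key : ∀ r, (b r).support ⊆ (b p).support ∪ (b q).support →
      coeffNorm r = ∑ w ∈ (b p).support ∪ (b q).support, |b r w| := fun r hr =>
    Finsupp.sum_of_support_subset _ hr _ (by simp)
  rw [key (p + q) (by rw [map_add]; exact Finsupp.support_add), key p Finset.subset_union_left,
    key q Finset.subset_union_right, ← Finset.sum_add_distrib]
  refine Finset.sum_le_sum fun w _ => ?_
  rw [map_add, Finsupp.add_apply]
  exact abs_add_le _ _

theorem coeffNorm_sum_le [IsStrictOrderedRing A] {ι : Type*} (s : Finset ι)
    (g : ι → FreeAlgebra A (Fin n)) : coeffNorm (∑ i ∈ s, g i) ≤ ∑ i ∈ s, coeffNorm (g i) :=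
  Finset.le_sum_of_subadditive _ coeffNorm_zero.le coeffNorm_add_le s g

theorem coeffNorm_smul [IsStrictOrderedRing A] (a : A) (p : FreeAlgebra A (Fin n)) :
    coeffNorm (a • p) = |a| * coeffNorm p := by
  rw [coeffNorm, map_smul, Finsupp.sum_smul_index (by simp), coeffNorm, Finsupp.mul_sum]
  simp only [abs_mul]

theorem coeffNorm_neg [IsStrictOrderedRing A] (p : FreeAlgebra A (Fin n)) :
    coeffNorm (-p) = coeffNorm p := by
  simpa using coeffNorm_smul (-1) p

theorem coeffNorm_star_le [IsStrictOrderedRing A] (p : FreeAlgebra A (Fin n)) :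
    coeffNorm (star p) ≤ coeffNorm p := by
  conv_lhs => rw [← sum_repr_wordPoly p, Finsupp.sum, star_sum]
  refine (coeffNorm_sum_le _ _).trans (Finset.sum_le_sum fun w _ => ?_)
  rw [star_smul_eq, star_wordPoly, coeffNorm_smul_wordPoly]

theorem coeffNorm_mul_le [IsStrictOrderedRing A] (p q : FreeAlgebra A (Fin n)) :
    coeffNorm (p * q) ≤ coeffNorm p * coeffNorm q := by
  conv_lhs => rw [← sum_repr_wordPoly p, ← sum_repr_wordPoly q, Finsupp.sum, Finsupp.sum,
    Finset.sum_mul_sum]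
  conv_rhs => rw [coeffNorm, coeffNorm, Finsupp.sum, Finsupp.sum, Finset.sum_mul_sum]
  refine (coeffNorm_sum_le _ _).trans (Finset.sum_le_sum fun v _ => ?_)
  refine (coeffNorm_sum_le _ _).trans (Finset.sum_le_sum fun w _ => ?_)
  rw [smul_mul_smul_comm, show wordPoly A v * wordPoly A w = wordPoly A (v * w) from
    (map_mul (FreeMonoid.lift (ι A)) v w).symm, coeffNorm_smul_wordPoly, abs_mul]

/-- An additive set containing `|a| + a w` for all scalars `a` and words `w` contains
`coeffNorm p + p` for all `p`. -/
theorem algebraMap_coeffNorm_add_mem (S : AddSubmonoid (FreeAlgebra A (Fin n)))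
    (hS : ∀ (a : A) (w : FreeMonoid (Fin n)), algebraMap A _ |a| + a • wordPoly A w ∈ S)
    (p : FreeAlgebra A (Fin n)) : algebraMap A _ (coeffNorm p) + p ∈ S := by
  have hsum : algebraMap A _ (coeffNorm p) + p =
      ∑ w ∈ ((basisFreeMonoid A (Fin n)).repr p).support,
        (algebraMap A _ |(basisFreeMonoid A (Fin n)).repr p w| +
          (basisFreeMonoid A (Fin n)).repr p w • wordPoly A w) := by
    rw [Finset.sum_add_distrib, ← map_sum]
    exact congrArg (_ + ·) (sum_repr_wordPoly p).symm
  rw [hsum]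
  exact S.sum_mem fun w _ => hS _ w

end coeffNorm

/-- The coefficient norm makes `ℝ⟨X⟩` a (semi)normed algebra. The instances are scoped because
they give a second path to the ring structure of `ℝ⟨X⟩`. -/
noncomputable scoped instance : SeminormedRing (FreeAlgebra ℝ (Fin n)) :=
  RingSeminorm.toSeminormedRing
    { toFun := coeffNorm
      map_zero' := coeffNorm_zero
      add_le' := coeffNorm_add_le
      neg' := coeffNorm_neg
      mul_le' := coeffNorm_mul_le }

theorem norm_eq_coeffNorm (p : FreeAlgebra ℝ (Fin n)) : ‖p‖ = coeffNorm p := rfl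

noncomputable scoped instance : NormedAlgebra ℝ (FreeAlgebra ℝ (Fin n)) where
  norm_smul_le a p := (coeffNorm_smul a p).le

scoped instance : ContinuousStar (FreeAlgebra ℝ (Fin n)) where
  continuous_star :=
    (AddMonoidHomClass.continuous_of_bound (starAddEquiv : FreeAlgebra ℝ (Fin n) ≃+ _) 1
      fun p => (coeffNorm_star_le p).trans_eq (one_mul _).symm)

end FreeAlgebra

/-! ### The cone of polynomials that are positive up to cyclic equivalence -/

section CubeModule

variable {R : Type*} [CommRing R] {n : ℕ}

theorem isQuadraticModule_cubeModule : IsQuadraticModule (cubeModule R n) :=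
  isQuadraticModule_generatedBy (by rintro _ ⟨i, rfl⟩; simp)

theorem star_mul_self_mem_cubeModule (g : FreeAlgebra R (Fin n)) :
    star g * g ∈ cubeModule R n := by
  simpa using isQuadraticModule_cubeModule.conj_mem g 1 isQuadraticModule_cubeModule.one_mem

/-- Induction on the word: `1 - (Xw)*(Xw) = (1 - w*w) + w*(1 - X²)w`. -/
theorem one_sub_star_wordPoly_mul_self_mem (w : FreeMonoid (Fin n)) :
    1 - star (wordPoly R w) * wordPoly R w ∈ cubeModule R n := by
  induction w using FreeMonoid.inductionOn' with
  | one => simpa [wordPoly] using star_mul_self_mem_cubeModule (R := R) (n := n) 0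
  | of_mul i w ih =>
    have hi : (1 - FreeAlgebra.ι R i ^ 2 : FreeAlgebra R (Fin n)) ∈ cubeModule R n :=
      fun M hM => hM.2 ⟨i, rfl⟩
    convert isQuadraticModule_cubeModule.add_mem _ ih _
      (isQuadraticModule_cubeModule.conj_mem (wordPoly R w) _ hi) using 1
    simp only [wordPoly, map_mul, star_mul, FreeMonoid.lift_eval_of, FreeAlgebra.star_ι]
    noncomm_ring

/-- With `s = ±1`, this is `(1 + s w)*(1 + s w) + (1 - w*w)`. -/
theorem two_add_wordPoly_mem (s : R) (hs : s * s = 1) (w : FreeMonoid (Fin n)) :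
    2 + s • (wordPoly R w + star (wordPoly R w)) ∈ cubeModule R n := by
  convert isQuadraticModule_cubeModule.add_mem _
    (star_mul_self_mem_cubeModule (1 + s • wordPoly R w)) _
    (one_sub_star_wordPoly_mul_self_mem w) using 1
  rw [star_add, FreeAlgebra.star_smul_eq, star_one, add_mul, mul_add, mul_add,
    smul_mul_smul_comm, hs, one_smul, smul_add]
  simp only [one_mul, mul_one]
  rw [← one_add_one_eq_two]
  abel

theorem mul_self_smul_mem_cubeModule (r : R) {m : FreeAlgebra R (Fin n)}
    (hm : m ∈ cubeModule R n) : (r * r) • m ∈ cubeModule R n := by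
  have := isQuadraticModule_cubeModule.conj_mem (algebraMap R _ r) m hm
  rwa [FreeAlgebra.star_algebraMap, mul_assoc, ← Algebra.commutes, ← mul_assoc, ← map_mul,
    ← Algebra.smul_def] at this

end CubeModule

theorem CyclicallyEquivalent.smul {R A : Type*} [CommRing R] [Ring A] [Algebra R A] (r : R)
    {f g : A} (h : CyclicallyEquivalent f g) : CyclicallyEquivalent (r • f) (r • g) := by
  unfold CyclicallyEquivalent at *
  rw [← smul_sub]
  generalize f - g = x at h
  induction h using AddSubmonoid.closure_induction with
  | mem x hx =>
    obtain ⟨p, q, rfl⟩ := hx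
    exact AddSubmonoid.subset_closure ⟨r • p, q, by rw [smul_sub, smul_mul_assoc, mul_smul_comm]⟩
  | zero => simp
  | add x y _ _ hx hy => simpa only [smul_add] using AddSubmonoid.add_mem _ hx hy

/-- The polynomials `x` for which `x + x*` is cyclically equivalent to an element of `M_R`. The
symmetrization makes all skew elements `p - p*` belong to this cone. -/
def tracialCone (R : Type*) [CommRing R] (n : ℕ) : AddSubmonoid (FreeAlgebra R (Fin n)) where
  carrier := {x | ∃ m ∈ cubeModule R n, CyclicallyEquivalent (x + star x) m}
  zero_mem' := ⟨0, by simpa using star_mul_self_mem_cubeModule (R := R) (n := n) 0,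
    by simp [CyclicallyEquivalent]⟩
  add_mem' := by
    rintro x y ⟨m, hm, hx⟩ ⟨k, hk, hy⟩
    refine ⟨m + k, isQuadraticModule_cubeModule.add_mem m hm k hk, ?_⟩
    have := AddSubmonoid.add_mem _ hx hy
    unfold CyclicallyEquivalent
    convert this using 1
    rw [star_add]
    abel

namespace tracialCone

section Ring

variable {R : Type*} [CommRing R] {n : ℕ}

theorem star_mul_self_mem (g : FreeAlgebra R (Fin n)) : star g * g ∈ tracialCone R n :=
  ⟨star g * g + star g * g, isQuadraticModule_cubeModule.add_mem _
    (star_mul_self_mem_cubeModule g) _ (star_mul_self_mem_cubeModule g),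
    by simp [CyclicallyEquivalent]⟩

theorem sub_star_mem (g : FreeAlgebra R (Fin n)) : g - star g ∈ tracialCone R n :=
  ⟨0, by simpa using star_mul_self_mem_cubeModule (R := R) (n := n) 0,
    by simp [CyclicallyEquivalent]⟩

theorem commutator_mem (p q : FreeAlgebra R (Fin n)) : p * q - q * p ∈ tracialCone R n := by
  refine ⟨0, by simpa using star_mul_self_mem_cubeModule (R := R) (n := n) 0, ?_⟩
  unfold CyclicallyEquivalent
  rw [sub_zero, star_sub, star_mul, star_mul]
  exact AddSubmonoid.add_mem _ (AddSubmonoid.subset_closure ⟨p, q, rfl⟩)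
    (AddSubmonoid.subset_closure ⟨star q, star p, rfl⟩)

theorem mul_self_smul_mem (r : R) {x : FreeAlgebra R (Fin n)} (hx : x ∈ tracialCone R n) :
    (r * r) • x ∈ tracialCone R n := by
  obtain ⟨m, hm, h⟩ := hx
  refine ⟨(r * r) • m, mul_self_smul_mem_cubeModule r hm, ?_⟩
  rw [FreeAlgebra.star_smul_eq, ← smul_add]
  exact h.smul _

theorem one_add_wordPoly_mem (s : R) (hs : s * s = 1) (w : FreeMonoid (Fin n)) :
    1 + s • wordPoly R w ∈ tracialCone R n := by
  refine ⟨_, two_add_wordPoly_mem s hs w, ?_⟩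
  unfold CyclicallyEquivalent
  convert AddSubmonoid.zero_mem _
  rw [star_add, FreeAlgebra.star_smul_eq, star_one, smul_add, ← one_add_one_eq_two]
  abel

end Ring

section RealClosed

variable {R : Type*} [Field R] [LinearOrder R] [IsStrictOrderedRing R] [IsRealClosed R] {n : ℕ}

theorem smul_mem {c : R} (hc : 0 ≤ c) {x : FreeAlgebra R (Fin n)} (hx : x ∈ tracialCone R n) :
    c • x ∈ tracialCone R n := by
  obtain ⟨r, rfl⟩ := IsSquare.of_nonneg hc
  exact mul_self_smul_mem r hx

theorem algebraMap_mem {c : R} (hc : 0 ≤ c) : algebraMap R _ c ∈ tracialCone R n := by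
  simpa [Algebra.smul_def] using smul_mem hc (star_mul_self_mem (R := R) (n := n) 1)

theorem algebraMap_abs_add_smul_wordPoly_mem (a : R) (w : FreeMonoid (Fin n)) :
    algebraMap R _ |a| + a • wordPoly R w ∈ tracialCone R n := by
  rcases le_total 0 a with ha | ha
  · convert smul_mem ha (one_add_wordPoly_mem (1 : R) (by simp) w) using 1
    rw [abs_of_nonneg ha, smul_add, one_smul, Algebra.algebraMap_eq_smul_one]
  · convert smul_mem (neg_nonneg.2 ha) (one_add_wordPoly_mem (-1 : R) (by simp) w) using 1
    rw [abs_of_nonpos ha, smul_add, smul_smul, Algebra.algebraMap_eq_smul_one]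
    simp

theorem algebraMap_add_mem {c : R} {p : FreeAlgebra R (Fin n)} (hc : FreeAlgebra.coeffNorm p ≤ c) :
    algebraMap R _ c + p ∈ tracialCone R n := by
  convert AddSubmonoid.add_mem _ (algebraMap_mem (sub_nonneg.2 hc))
    (FreeAlgebra.algebraMap_coeffNorm_add_mem _ algebraMap_abs_add_smul_wordPoly_mem p) using 1
  rw [map_sub]
  abel

/-- For symmetric elements, membership in the cone is the positivity sought. -/
theorem exists_cyclicallyEquivalent {x : FreeAlgebra R (Fin n)} (hx : x ∈ tracialCone R n)
    (hsymm : star x = x) : ∃ m ∈ cubeModule R n, CyclicallyEquivalent x m := by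
  obtain ⟨m, hm, h⟩ := smul_mem (show (0 : R) ≤ 1 / 2 by norm_num) hx
  refine ⟨m, hm, ?_⟩
  rwa [FreeAlgebra.star_smul_eq, hsymm, ← add_smul, add_halves, one_smul] at h

end RealClosed

end tracialCone

/-! ### Passing to the residue field -/

section Residue

open ArchimedeanClass FreeAlgebra

variable {R : Type*} [Field R] [LinearOrder R] [IsStrictOrderedRing R] {n : ℕ}

theorem finiteInclusion_monotone : Monotone (finiteInclusion R) := fun _ _ h => h

theorem finiteResidue_monotone : Monotone (finiteResidue R) := fun a b h =>
  stdPart_monotoneOn a.2 b.2 h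

theorem finiteResidue_ratCast (q : ℚ) : finiteResidue R (q : FiniteElement R) = q := by
  rw [← FiniteElement.mk_ratCast]
  exact stdPart_ratCast q

theorem finiteInclusion_ratCast (q : ℚ) : finiteInclusion R (q : FiniteElement R) = q := by
  rw [← FiniteElement.mk_ratCast]
  rfl

theorem denseRange_finiteResidue : DenseRange (finiteResidue R) :=
  Rat.denseRange_cast.mono (by rintro _ ⟨q, rfl⟩; exact ⟨q, finiteResidue_ratCast q⟩)

/-- The closure of the image contains the variables and, by density, the real constants, and it is
a subring. -/
theorem denseRange_mapCoeff_finiteResidue : DenseRange (mapCoeff (finiteResidue R) n) := by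
  let T : Subring (FreeAlgebra ℝ (Fin n)) := (mapCoeff (finiteResidue R) n).range.topologicalClosure
  have hT : ∀ p, p ∈ T := by
    intro p
    induction p using FreeAlgebra.induction with
    | grade0 a =>
      refine denseRange_finiteResidue (R := R) |>.induction_on
        (p := fun a => algebraMap ℝ (FreeAlgebra ℝ (Fin n)) a ∈ T) a ?_ fun r => ?_
      · exact (Subring.isClosed_topologicalClosure _).preimage (continuous_algebraMap ℝ _)
      · exact subset_closure ⟨algebraMap _ _ r, mapCoeff_const _ n r⟩
    | grade1 i => exact subset_closure ⟨ι _ i, mapCoeff_var _ n i⟩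
    | mul p q hp hq => exact T.mul_mem hp hq
    | add p q hp hq => exact T.add_mem hp hq
  exact hT

/-- The closure in `ℝ⟨X⟩` of the residues of those polynomials over `𝒪` which lie in the tracial
cone over `R`. -/
noncomputable def residueCone (R : Type*) [Field R] [LinearOrder R] [IsStrictOrderedRing R]
    (n : ℕ) : AddSubmonoid (FreeAlgebra ℝ (Fin n)) :=
  (((tracialCone R n).comap (mapCoeff (finiteInclusion R) n)).map
    (mapCoeff (finiteResidue R) n)).topologicalClosure

theorem mapCoeff_mem_residueCone {h : FreeAlgebra (FiniteElement R) (Fin n)}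
    (hh : mapCoeff (finiteInclusion R) n h ∈ tracialCone R n) :
    mapCoeff (finiteResidue R) n h ∈ residueCone R n :=
  subset_closure ⟨h, hh, rfl⟩

theorem isClosed_residueCone : IsClosed (residueCone R n : Set (FreeAlgebra ℝ (Fin n))) :=
  isClosed_closure

theorem star_mul_self_mem_residueCone (p : FreeAlgebra ℝ (Fin n)) :
    star p * p ∈ residueCone R n := by
  refine denseRange_mapCoeff_finiteResidue (R := R) |>.induction_on
    (p := fun p => star p * p ∈ residueCone R n) p
    (isClosed_residueCone.preimage (by fun_prop)) fun h => ?_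
  rw [← mapCoeff_star, ← map_mul]
  refine mapCoeff_mem_residueCone ?_
  rw [map_mul, mapCoeff_star]
  exact tracialCone.star_mul_self_mem _

theorem sub_star_mem_residueCone (p : FreeAlgebra ℝ (Fin n)) :
    p - star p ∈ residueCone R n := by
  refine denseRange_mapCoeff_finiteResidue (R := R) |>.induction_on
    (p := fun p => p - star p ∈ residueCone R n) p
    (isClosed_residueCone.preimage (by fun_prop)) fun h => ?_
  rw [← mapCoeff_star, ← map_sub]
  refine mapCoeff_mem_residueCone ?_
  rw [map_sub, mapCoeff_star]
  exact tracialCone.sub_star_mem _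

theorem commutator_mem_residueCone (p q : FreeAlgebra ℝ (Fin n)) :
    p * q - q * p ∈ residueCone R n := by
  refine denseRange_mapCoeff_finiteResidue (R := R) |>.induction_on₂
    (p := fun p q => p * q - q * p ∈ residueCone R n)
    (isClosed_residueCone.preimage (f := fun x : _ × _ => x.1 * x.2 - x.2 * x.1) (by fun_prop))
    (fun h k => ?_) p q
  rw [← map_mul, ← map_mul, ← map_sub]
  refine mapCoeff_mem_residueCone ?_
  rw [map_sub, map_mul, map_mul]
  exact tracialCone.commutator_mem _ _

theorem one_add_wordPoly_mem_residueCone (s : FiniteElement R) (hs : s * s = 1)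
    (w : FreeMonoid (Fin n)) : 1 + finiteResidue R s • wordPoly ℝ w ∈ residueCone R n := by
  have := mapCoeff_mem_residueCone (R := R) (h := 1 + s • wordPoly _ w) (by
    rw [map_add, map_one, mapCoeff_smul, mapCoeff_wordPoly]
    exact tracialCone.one_add_wordPoly_mem _ (by rw [← map_mul, hs, map_one]) w)
  rwa [map_add, map_one, mapCoeff_smul, mapCoeff_wordPoly] at this

theorem smul_mem_residueCone {c : ℝ} (hc : 0 ≤ c) {x : FreeAlgebra ℝ (Fin n)}
    (hx : x ∈ residueCone R n) : c • x ∈ residueCone R n := by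
  obtain ⟨r, rfl⟩ := (Real.isSquare_iff.2 hc)
  refine denseRange_finiteResidue (R := R) |>.induction_on
    (p := fun r => (r * r) • x ∈ residueCone R n) r
    (isClosed_residueCone.preimage (by fun_prop)) fun a => ?_
  refine map_mem_closure (continuous_const_smul _) hx ?_
  rintro _ ⟨h, hh, rfl⟩
  refine ⟨(a * a) • h, ?_, by rw [← map_mul]; exact mapCoeff_smul _ _ h⟩
  change mapCoeff (finiteInclusion R) n _ ∈ tracialCone R n
  rw [mapCoeff_smul, map_mul]
  exact tracialCone.mul_self_smul_mem _ hh

theorem algebraMap_coeffNorm_add_mem_residueCone (p : FreeAlgebra ℝ (Fin n)) :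
    algebraMap ℝ _ (coeffNorm p) + p ∈ residueCone R n := by
  refine algebraMap_coeffNorm_add_mem _ (fun a w => ?_) p
  rcases le_total 0 a with ha | ha
  · convert smul_mem_residueCone ha (one_add_wordPoly_mem_residueCone (1 : FiniteElement R)
      (by simp) w) using 1
    rw [abs_of_nonneg ha, smul_add, map_one, one_smul, Algebra.algebraMap_eq_smul_one]
  · convert smul_mem_residueCone (neg_nonneg.2 ha)
      (one_add_wordPoly_mem_residueCone (-1 : FiniteElement R) (by simp) w) using 1
    rw [abs_of_nonpos ha, smul_add, smul_smul, Algebra.algebraMap_eq_smul_one]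
    simp

/-- A normalized functional that is nonnegative on the residue cone is a tracial contraction
state. -/
theorem isTracialContractionState_of_nonneg {φ : FreeAlgebra ℝ (Fin n) →ₗ[ℝ] ℝ}
    (hφ : ∀ p ∈ residueCone R n, 0 ≤ φ p) (h1 : φ 1 = 1) : IsTracialContractionState φ where
  tracial p q := by
    have h₁ := hφ _ (commutator_mem_residueCone p q)
    have h₂ := hφ _ (commutator_mem_residueCone q p)
    rw [map_sub] at h₁ h₂
    linarith
  contraction w := by
    have h₁ := hφ _ (one_add_wordPoly_mem_residueCone 1 (by simp) w)
    have h₂ := hφ _ (one_add_wordPoly_mem_residueCone (-1) (by simp) w)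
    simp only [map_add, map_smul, map_one, map_neg, h1, smul_eq_mul] at h₁ h₂
    rw [abs_le]
    constructor <;> linarith
  hermitian_square_nonneg p := hφ _ (star_mul_self_mem_residueCone p)
  map_one := h1
  map_star p := by
    have h₁ := hφ _ (sub_star_mem_residueCone p)
    have h₂ := hφ _ (sub_star_mem_residueCone (star p))
    rw [star_star] at h₂
    rw [map_sub] at h₁ h₂
    linarith

theorem add_algebraMap_mem_residueCone {x : FreeAlgebra ℝ (Fin n)}
    (hx : ∀ φ : FreeAlgebra ℝ (Fin n) →ₗ[ℝ] ℝ, IsTracialContractionState φ → 0 ≤ φ x)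
    {δ : ℝ} (hδ : 0 < δ) : x + algebraMap ℝ _ δ ∈ residueCone R n := by
  by_contra hmem
  let K : PointedCone ℝ (FreeAlgebra ℝ (Fin n)) :=
    { residueCone R n with smul_mem' := fun c _ h => smul_mem_residueCone c.2 h }
  obtain ⟨φ, hφ, hφ1, hφx⟩ := exists_nonneg_functional_of_notMem K (u := 1)
    (show (1 : FreeAlgebra ℝ (Fin n)) ∈ residueCone R n by
      simpa using star_mul_self_mem_residueCone (R := R) (n := n) 1)
    (fun v => ⟨coeffNorm v, by
      rw [← Algebra.algebraMap_eq_smul_one]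
      exact algebraMap_coeffNorm_add_mem_residueCone v⟩) hmem
  have := hx φ (isTracialContractionState_of_nonneg hφ hφ1)
  rw [map_add, Algebra.algebraMap_eq_smul_one, map_smul, hφ1, smul_eq_mul, mul_one] at hφx
  linarith

/-- Standard parts reflect strict inequalities, so an approximation of the residue by the residue
of an element of the cone lifts to `R` at the cost of a rational constant. -/
theorem add_algebraMap_mem_tracialCone [IsRealClosed R] {f : FreeAlgebra (FiniteElement R) (Fin n)}
    (hf : mapCoeff (finiteResidue R) n f ∈ residueCone R n) {δ : ℚ} (hδ : 0 < δ) :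
    mapCoeff (finiteInclusion R) n f + algebraMap R _ (δ : R) ∈ tracialCone R n := by
  obtain ⟨_, ⟨h, hh, rfl⟩, hdist⟩ := Metric.mem_closure_iff.1 hf (δ : ℝ) (by exact_mod_cast hδ)
  rw [dist_eq_norm, norm_eq_coeffNorm, ← map_sub,
    coeffNorm_mapCoeff finiteResidue_monotone, ← finiteResidue_ratCast (R := R)] at hdist
  have hle := finiteInclusion_monotone (finiteResidue_monotone.reflect_lt hdist).le
  rw [← coeffNorm_mapCoeff finiteInclusion_monotone, finiteInclusion_ratCast] at hle
  convert AddSubmonoid.add_mem _ (tracialCone.algebraMap_add_mem hle) hh using 1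
  rw [map_sub]
  abel

end Residue

theorem proposition5p7 {R : Type*} [Field R] [LinearOrder R] [IsStrictOrderedRing R]
    [IsRealClosed R] (n : ℕ)
    (f : FreeAlgebra (ArchimedeanClass.FiniteElement R) (Fin n)) (hf : star f = f)
    (hφ : ∀ φ : FreeAlgebra ℝ (Fin n) →ₗ[ℝ] ℝ, IsTracialContractionState φ →
      0 ≤ φ (mapCoeff (finiteResidue R) n f))
    (ε : R) (hε : 0 < ε) (hεm : ε ∉ infinitesimals R) :
    ∃ g ∈ cubeModule R n,
      CyclicallyEquivalent (mapCoeff (finiteInclusion R) n f + algebraMap R _ ε) g := by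
  obtain ⟨δ, hδ, hδε⟩ : ∃ δ : ℚ, 0 < δ ∧ ((δ + δ : ℚ) : R) ≤ ε := by
    simp only [infinitesimals, Set.mem_ofPred_eq, not_forall, not_le, abs_of_pos hε] at hεm
    obtain ⟨N, hN⟩ := hεm
    have hN0 : 0 < N := Nat.pos_of_ne_zero (by rintro rfl; norm_num at hN)
    have hN0' : (0 : R) < N := by exact_mod_cast hN0
    refine ⟨1 / N / 2, by positivity, ?_⟩
    rw [add_halves]
    push_cast
    rw [div_le_iff₀ hN0', mul_comm]
    exact hN.le
  -- one `δ` is spent over `ℝ`, the other on the way back to `R`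
  have h₁ := add_algebraMap_mem_residueCone (R := R) hφ (δ := δ) (by exact_mod_cast hδ)
  rw [← finiteResidue_ratCast (R := R), ← mapCoeff_const, ← map_add] at h₁
  have h₂ := add_algebraMap_mem_tracialCone h₁ hδ
  refine tracialCone.exists_cyclicallyEquivalent ?_ ?_
  · convert AddSubmonoid.add_mem _ h₂ (tracialCone.algebraMap_mem (sub_nonneg.2 hδε)) using 1
    rw [map_add, mapCoeff_const, finiteInclusion_ratCast, Rat.cast_add, map_sub, map_add]
    abel
  · rw [star_add, ← FreeAlgebra.mapCoeff_star, hf, FreeAlgebra.star_algebraMap]
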